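/- Let $p>5$ be a prime. For $r\in\{0,1,2\}$ put $$\sigma_r=\sum_{k=1}^{p-1}\binom pk^2\binom{p+k-1}{k-1}k^r,$$ let $H_{p-1}=\sum_{k=1}^{p-1}\frac1k$, and let $B_0,B_1,B_2,\ldots$ be the Bernoulli numbers, given by $B_0=1$ and $\sum_{k=0}^{n}\binom{n+1}kB_k=0$ for all integers $n\geq 1$. For rational numbers $a,b$ and a positive integer $n$, write $a\equiv b\pmod{p^n}$ if $a-b=p^n c$ for some rational number $c$ whose denominator in lowest terms is not divisible by $p$. Then $$\sigma_0\equiv pH_{p-1}+\frac{9}{10}p^5B_{p-5}\pmod{p^6},$$ $$\sigma_1\equiv-3p^2H_{p-1}+\frac{21}{10}p^6B_{p-5}\pmod{p^7},$$ and $$\sigma_2\equiv-p^2-(4p^5+4p^4+2p^3)H_{p-1}+\frac45p^7B_{p-5}\pmod{p^8}.$$ -/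

import Mathlib

/-- Congruence of rational numbers modulo a natural number `m`: `a - b = m * c` for some rational
number `c` whose denominator (in lowest terms) is coprime to `m`. For `m = p ^ n` with `p` prime and
`n > 0`, this is congruence modulo `p ^ n` in the ring of rationals with denominator prime to `p`. -/
def RatModEq (m : ℕ) (a b : ℚ) : Prop :=
  ∃ c : ℚ, c.den.Coprime m ∧ a - b = (m : ℚ) * c

/-- The sum `∑_{k=1}^{p-1} (p choose k)² (p+k-1 choose k-1) k^r`. -/
def binomSum (p r : ℕ) : ℕ :=
  ∑ k ∈ Finset.Icc 1 (p - 1), p.choose k ^ 2 * (p + k - 1).choose (k - 1) * k ^ r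

/-! Write M_k = ∏_{j≤k}(1 - p/j), S_k = ∏_{j≤k}(1 - p²/j²), P_m = ∑_{k<p} k^(-m) and T_m = ∑_{k<p}
M_{k-1} S_{k-1} / k^m. The summand of σ_r is exactly p² M_{k-1} S_{k-1} k^(r-2), so σ_r = p² T_{2-r}
(`binomSum_eq_sum`). Telescoping M_n S_n and n M_n S_n, with M_{p-1} = 1, gives two exact linear
relations among the T_m and S_{p-1} (`mixedProdSum_relation`, `mixedProdSum_zero_relation`). It
remains to find T_2 mod p^4, T_3 mod p^3 and S_{p-1} mod p^6.

In T_2 and T_3 only S is expanded in the leading term: the sums ∑ M_{k-1}/k^m left over have closed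
forms in P_1 and P_2 (`minusProdSum_two`, `minusProdSum_three`), because alternating binomial sums
are complete homogeneous symmetric functions of 1, 1/2, ..., 1/n. The correction terms are multiple
harmonic sums of weight 5, which are multiples of B_{p-5} mod p (`doubleSum_pDvd`,
`sum_powSum_mul_pDvd`). The reflection k ↦ p - k links P_1, P_2, P_3, P_4, and `powSum_four_pDvd`
gives P_4 mod p², so that everything reduces to P_1 = H_{p-1} and B_{p-5}. -/

/-- `PDvd p n x` says that `x` is `p ^ n` times a rational number whose denominator is
coprime to `p`. -/
def PDvd (p n : ℕ) (x : ℚ) : Prop :=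
  ∃ c : ℚ, c.den.Coprime p ∧ x = (p : ℚ) ^ n * c

/-! ### Calculus of p-adic divisibility for rationals. -/

namespace PDvd

variable {p m n : ℕ} {x y : ℚ}

lemma add (hx : PDvd p n x) (hy : PDvd p n y) : PDvd p n (x + y) := by
  obtain ⟨c, hc, rfl⟩ := hx
  obtain ⟨d, hd, rfl⟩ := hy
  exact ⟨c + d, Nat.Coprime.of_dvd_left (Rat.add_den_dvd c d) (hc.mul_left hd), by ring⟩

lemma mul (hx : PDvd p m x) (hy : PDvd p n y) : PDvd p (m + n) (x * y) := by
  obtain ⟨c, hc, rfl⟩ := hx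
  obtain ⟨d, hd, rfl⟩ := hy
  exact ⟨c * d, Nat.Coprime.of_dvd_left (Rat.mul_den_dvd c d) (hc.mul_left hd), by ring⟩

lemma neg (hx : PDvd p n x) : PDvd p n (-x) := by
  obtain ⟨c, hc, rfl⟩ := hx
  exact ⟨-c, by simpa using hc, by ring⟩

lemma sub (hx : PDvd p n x) (hy : PDvd p n y) : PDvd p n (x - y) := by
  rw [sub_eq_add_neg]
  exact hx.add hy.neg

lemma zero : PDvd p n 0 := ⟨0, by simp, by simp⟩

lemma natCast (a : ℕ) : PDvd p 0 (a : ℚ) := ⟨a, by simp, by simp⟩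

lemma one : PDvd p 0 1 := by simpa using natCast (p := p) 1

lemma inv_natCast (hp : p.Prime) {a : ℕ} (ha : ¬ p ∣ a) : PDvd p 0 ((a : ℚ)⁻¹) := by
  refine ⟨(a : ℚ)⁻¹, ?_, by simp⟩
  have h0 : 0 < a := Nat.pos_of_ne_zero fun h => ha (h ▸ dvd_zero p)
  rw [Rat.inv_natCast_den_of_pos h0]
  exact ((Nat.Prime.coprime_iff_not_dvd hp).2 ha).symm

lemma inv_of_lt (hp : p.Prime) {a : ℕ} (h0 : 0 < a) (ha : a < p) : PDvd p 0 ((a : ℚ)⁻¹) :=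
  inv_natCast hp fun h => absurd (Nat.le_of_dvd h0 h) (by omega)

lemma self_pow : PDvd p n ((p : ℚ) ^ n) := ⟨1, by simp, by simp⟩

lemma mono (h : m ≤ n) (hx : PDvd p n x) : PDvd p m x := by
  obtain ⟨c, hc, rfl⟩ := hx
  obtain ⟨d, rfl⟩ := Nat.exists_eq_add_of_le h
  have h1 : PDvd p (m + 0) ((p : ℚ) ^ m * ((p : ℚ) ^ d * c)) := by
    refine self_pow.mul ?_
    have h2 : PDvd p 0 ((p ^ d : ℕ) : ℚ) := natCast _
    have h3 : PDvd p 0 c := ⟨c, hc, by simp⟩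
    simpa using h2.mul h3
  have e : (p : ℚ) ^ (m + d) * c = (p : ℚ) ^ m * ((p : ℚ) ^ d * c) := by ring
  rw [e]
  exact h1

lemma mul_left (hx : PDvd p 0 x) (hy : PDvd p n y) : PDvd p n (x * y) := by
  simpa using hx.mul hy

lemma mul_right (hx : PDvd p n x) (hy : PDvd p 0 y) : PDvd p n (x * y) := hx.mul hy

lemma pow (hx : PDvd p 0 x) (k : ℕ) : PDvd p 0 (x ^ k) := by
  induction k with
  | zero => simpa using one
  | succ k ih => rw [pow_succ]; exact ih.mul hx

lemma sum {ι : Type*} {s : Finset ι} {f : ι → ℚ} (h : ∀ i ∈ s, PDvd p n (f i)) :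
    PDvd p n (∑ i ∈ s, f i) := by
  classical
  induction s using Finset.induction_on with
  | empty => simpa using zero
  | insert a s ha ih =>
    rw [Finset.sum_insert ha]
    exact (h a (by simp)).add (ih fun i hi => h i (by simp [hi]))

/-- Multiplication by a power of `p`. -/
lemma pow_mul (m : ℕ) (hx : PDvd p n x) : PDvd p (m + n) ((p : ℚ) ^ m * x) := self_pow.mul hx

lemma of_natCast_dvd {a : ℕ} (h : p ∣ a) : PDvd p 1 (a : ℚ) := by
  obtain ⟨b, rfl⟩ := h
  simpa using (self_pow (p := p) (n := 1)).mul (natCast (p := p) b)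

lemma of_intCast_dvd {a : ℤ} (h : (p : ℤ) ∣ a) : PDvd p 1 (a : ℚ) := by
  obtain ⟨b, rfl⟩ := h
  exact ⟨b, by simp, by simp⟩

end PDvd

/-! ### Harmonic sums and Bernoulli numbers modulo p. -/

/-- The generalized harmonic number `∑_{j=1}^{n} 1 / j ^ m`. -/
def powSum (m n : ℕ) : ℚ := ∑ j ∈ Finset.range n, (((j + 1 : ℕ) : ℚ)⁻¹) ^ m

lemma powSum_succ (m n : ℕ) :
    powSum m (n + 1) = powSum m n + (((n + 1 : ℕ) : ℚ)⁻¹) ^ m := by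
  simp [powSum, Finset.sum_range_succ]

lemma powSum_zero_right (m : ℕ) : powSum m 0 = 0 := by simp [powSum]

lemma powSum_one_eq_harmonic (n : ℕ) : powSum 1 n = harmonic n := by
  simp [powSum, harmonic]

lemma PDvd.inv_succ {p i : ℕ} (hp : p.Prime) (hi : i < p - 1) :
    PDvd p 0 (((i + 1 : ℕ) : ℚ)⁻¹) := PDvd.inv_of_lt hp (by omega) (by omega)

lemma PDvd.powSum {p : ℕ} (hp : p.Prime) (m : ℕ) {n : ℕ} (hn : n ≤ p - 1) :
    PDvd p 0 (powSum m n) :=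
  PDvd.sum fun _ hi => (PDvd.inv_succ hp (by simp at hi; omega)).pow m

/-- The recurrence for the Bernoulli numbers divides only by n + 1, which is smaller than p. -/
lemma bernoulli_pDvd_zero {p : ℕ} (hp : p.Prime) {n : ℕ} (hn : n < p - 1) :
    PDvd p 0 (bernoulli n) := by
  induction n using Nat.strong_induction_on with
  | _ n ih =>
    have h := sum_bernoulli (n + 1)
    rw [Finset.sum_range_succ] at h
    have hn0 : ((n + 1 : ℕ) : ℚ) ≠ 0 := by positivity
    have hc : ((n + 1).choose n : ℚ) = ((n + 1 : ℕ) : ℚ) := by simp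
    rw [hc] at h
    have e : bernoulli n = ((n + 1 : ℕ) : ℚ)⁻¹ * ((if n + 1 = 1 then 1 else 0) -
        ∑ k ∈ Finset.range n, ((n + 1).choose k : ℚ) * bernoulli k) := by
      rw [← h]; field_simp; ring
    rw [e]
    refine PDvd.mul_left (PDvd.inv_succ hp hn) (PDvd.sub ?_ (PDvd.sum fun k hk => ?_))
    · split_ifs
      · exact PDvd.one
      · exact PDvd.zero
    · simp at hk
      exact PDvd.mul_left (PDvd.natCast _) (ih k hk (by omega))

/-- Power sums `∑_{k=1}^{p-1} k ^ e` vanish modulo `p` unless `p - 1 ∣ e`. -/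
lemma sum_pow_pDvd {p : ℕ} (hp : p.Prime) {e : ℕ} (he : ¬ (p - 1) ∣ e) :
    PDvd p 1 (∑ i ∈ Finset.range (p - 1), (((i + 1 : ℕ) : ℚ)) ^ e) := by
  have := Fact.mk hp
  have key : ((∑ i ∈ Finset.range (p - 1), (i + 1) ^ e : ℕ) : ZMod p) = 0 := by
    have he0 : e ≠ 0 := fun h => he (h ▸ dvd_zero _)
    have h1 : (∑ x : ZMod p, x ^ e) = 0 := by
      have hd : ∑ x : ZMod p, x ^ e = ∑ x : (ZMod p)ˣ, (x ^ e : ZMod p) := by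
        rw [← Finset.sum_filter_add_sum_filter_not Finset.univ (fun x : ZMod p => x = 0)]
        have hz : ∑ x ∈ Finset.univ.filter (fun x : ZMod p => x = 0), x ^ e = 0 := by
          apply Finset.sum_eq_zero
          intro x hx
          simp at hx
          simp [hx, he0]
        rw [hz, zero_add]
        symm
        refine Finset.sum_bij (fun (u : (ZMod p)ˣ) _ => (u : ZMod p)) ?_ ?_ ?_ ?_
        · intro a _; simp
        · intro a _ b _ hab; exact Units.ext hab
        · intro b hb; simp at hb; exact ⟨Units.mk0 b hb, by simp, by simp⟩
        · intro a _; simp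
      rw [hd, FiniteField.sum_pow_units, ZMod.card, if_neg he]
    have h2 : (∑ x : ZMod p, x ^ e) = ∑ i ∈ Finset.range p, ((i : ℕ) : ZMod p) ^ e := by
      symm
      refine Finset.sum_bij (fun i _ => (i : ZMod p)) ?_ ?_ ?_ ?_
      · intro a _; simp
      · intro a ha b hb hab
        simp at ha hb
        have := congrArg ZMod.val hab
        simpa [ZMod.val_natCast, Nat.mod_eq_of_lt ha, Nat.mod_eq_of_lt hb] using this
      · intro b _
        exact ⟨b.val, by simpa using ZMod.val_lt b, by simp⟩
      · intro a _; rfl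
    rw [h1] at h2
    have hp1 : p = (p - 1) + 1 := by have := hp.pos; omega
    have h3 : ∑ i ∈ Finset.range p, ((i : ℕ) : ZMod p) ^ e
        = ∑ i ∈ Finset.range (p - 1 + 1), ((i : ℕ) : ZMod p) ^ e := by rw [← hp1]
    rw [h3, Finset.sum_range_succ'] at h2
    push_cast at h2 ⊢
    simpa [he0] using h2.symm
  rw [ZMod.natCast_eq_zero_iff] at key
  have := PDvd.of_natCast_dvd key
  push_cast at this ⊢
  exact this

/-- Fermat: `k ^ (-m) ≡ k ^ (p - 1 - m)` modulo `p`. -/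
lemma inv_pow_sub_pow_pDvd {p : ℕ} (hp : p.Prime) {i m : ℕ} (hi : i < p - 1) (hm : m ≤ p - 1) :
    PDvd p 1 ((((i + 1 : ℕ) : ℚ)⁻¹) ^ m - ((i + 1 : ℕ) : ℚ) ^ (p - 1 - m)) := by
  have h1 : PDvd p 1 (((1 - ((i + 1 : ℕ) : ℤ) ^ (p - 1) : ℤ)) : ℚ) := by
    apply PDvd.of_intCast_dvd
    have hc : IsCoprime ((i + 1 : ℕ) : ℤ) p := by
      rw [Nat.isCoprime_iff_coprime]
      exact Nat.Coprime.symm (Nat.coprime_of_lt_prime (by omega) (by omega) hp)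
    have := Int.ModEq.pow_card_sub_one_eq_one hp hc
    exact Int.modEq_iff_dvd.1 this
  have e : (((i + 1 : ℕ) : ℚ)⁻¹) ^ m - ((i + 1 : ℕ) : ℚ) ^ (p - 1 - m)
      = (((i + 1 : ℕ) : ℚ)⁻¹) ^ m * (((1 - ((i + 1 : ℕ) : ℤ) ^ (p - 1) : ℤ)) : ℚ) := by
    have h0 : ((i + 1 : ℕ) : ℚ) ≠ 0 := by positivity
    have h2 : ((i + 1 : ℕ) : ℚ) ^ (p - 1) =
        ((i + 1 : ℕ) : ℚ) ^ (p - 1 - m) * ((i + 1 : ℕ) : ℚ) ^ m := by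
      rw [← pow_add]; congr 1; omega
    have h3 : ((((1 - ((i + 1 : ℕ) : ℤ) ^ (p - 1) : ℤ)) : ℚ)) = 1 - ((i + 1 : ℕ) : ℚ) ^ (p - 1) := by
      push_cast; ring
    rw [h3, h2, inv_pow]
    field_simp
  rw [e]
  exact PDvd.mul_left ((PDvd.inv_succ hp hi).pow m) h1

/-- Fermat turns the exponent -m into p - 1 - m, which lies strictly between 0 and p - 1. -/
lemma powSum_pDvd_one {p : ℕ} (hp : p.Prime) {m : ℕ} (h0 : 0 < m) (hm : m < p - 1) :
    PDvd p 1 (powSum m (p - 1)) := by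
  have e : powSum m (p - 1) = ∑ i ∈ Finset.range (p - 1),
      ((((i + 1 : ℕ) : ℚ)⁻¹) ^ m - ((i + 1 : ℕ) : ℚ) ^ (p - 1 - m)) +
      ∑ i ∈ Finset.range (p - 1), ((i + 1 : ℕ) : ℚ) ^ (p - 1 - m) := by
    rw [← Finset.sum_add_distrib]; simp [powSum]
  rw [e]
  refine (PDvd.sum fun i hi => inv_pow_sub_pow_pDvd hp (by simpa using hi) hm.le).add
    (sum_pow_pDvd hp fun h => absurd (Nat.le_of_dvd (by omega) h) (by omega))

/-! ### Double sums and alternating binomial sums. -/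

/-- The double harmonic sum `∑_{1 ≤ j < k ≤ n} 1 / (j ^ a * k ^ b)`. -/
def doubleSum (a b n : ℕ) : ℚ :=
  ∑ i ∈ Finset.range n, powSum a i * (((i + 1 : ℕ) : ℚ)⁻¹) ^ b

/-- The product of two power sums splits according to j < k, j > k and j = k. -/
lemma doubleSum_add_swap (a b n : ℕ) :
    doubleSum a b n + doubleSum b a n + powSum (a + b) n = powSum a n * powSum b n := by
  induction n with
  | zero => simp [doubleSum, powSum]
  | succ n ih =>
    have h (a b : ℕ) : doubleSum a b (n + 1) =
        doubleSum a b n + powSum a n * (((n + 1 : ℕ) : ℚ)⁻¹) ^ b := by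
      simp [doubleSum, Finset.sum_range_succ]
    rw [h, h, powSum_succ, powSum_succ, powSum_succ]
    linear_combination ih

/-- The alternating sum `∑_{k=1}^{n} (-1) ^ (k - 1) * (n choose k) / k ^ m`. -/
def altChooseSum (m n : ℕ) : ℚ :=
  ∑ i ∈ Finset.range n, (-1) ^ i * (n.choose (i + 1) : ℚ) * (((i + 1 : ℕ) : ℚ)⁻¹) ^ m

/-- Pascal's rule and absorption. This is the recursion of the complete homogeneous symmetric
function h_m(1, 1/2, ..., 1/n), so the closed forms below are its expressions in power sums. -/
lemma altChooseSum_succ (m n : ℕ) :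
    altChooseSum (m + 1) (n + 1) =
      altChooseSum (m + 1) n + ((n + 1 : ℕ) : ℚ)⁻¹ * altChooseSum m (n + 1) := by
  have h1 : altChooseSum (m + 1) n = ∑ i ∈ Finset.range (n + 1),
      (-1) ^ i * (n.choose (i + 1) : ℚ) * (((i + 1 : ℕ) : ℚ)⁻¹) ^ (m + 1) := by
    rw [Finset.sum_range_succ]
    simp [altChooseSum]
  rw [h1, altChooseSum, altChooseSum, Finset.mul_sum, ← Finset.sum_add_distrib]
  refine Finset.sum_congr rfl fun i _ => ?_
  have h2 : ((n + 1 : ℕ) : ℚ) * (n.choose i : ℚ)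
      = ((n + 1).choose (i + 1) : ℚ) * ((i + 1 : ℕ) : ℚ) := by
    exact_mod_cast Nat.add_one_mul_choose_eq n i
  have h3 : ((n + 1).choose (i + 1) : ℚ) = n.choose i + n.choose (i + 1) := by
    rw [Nat.choose_succ_succ]; push_cast; ring
  have h4 : ((n + 1 : ℕ) : ℚ) ≠ 0 := by positivity
  have h5 : ((i + 1 : ℕ) : ℚ) ≠ 0 := by positivity
  have h6 : ((n + 1 : ℕ) : ℚ)⁻¹ * ((n + 1).choose (i + 1) : ℚ)
      = (n.choose i : ℚ) * ((i + 1 : ℕ) : ℚ)⁻¹ := by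
    field_simp; linear_combination -h2
  generalize ((i + 1 : ℕ) : ℚ)⁻¹ = x at *
  generalize ((n + 1 : ℕ) : ℚ)⁻¹ = y at *
  rw [pow_succ]
  linear_combination ((-1) ^ i * x ^ m * x) * h3 - (-1) ^ i * x ^ m * h6

lemma altChooseSum_zero_left (n : ℕ) : altChooseSum 0 (n + 1) = 1 := by
  have h := Int.alternating_sum_range_choose (n := n + 1)
  rw [Finset.sum_range_succ'] at h
  have h2 : ((∑ k ∈ Finset.range (n + 1), (-1) ^ (k + 1) * ((n + 1).choose (k + 1) : ℤ)
    : ℤ) : ℚ) = -1 := by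
    simp only [Nat.succ_ne_zero, if_false] at h
    have : (∑ k ∈ Finset.range (n + 1), (-1) ^ (k + 1) * ((n + 1).choose (k + 1) : ℤ)) = -1 := by
      simp at h ⊢; linarith
    exact_mod_cast this
  push_cast at h2
  have h3 : altChooseSum 0 (n + 1) =
      - ∑ k ∈ Finset.range (n + 1), (-1) ^ (k + 1) * ((n + 1).choose (k + 1) : ℚ) := by
    rw [altChooseSum, ← Finset.sum_neg_distrib]
    refine Finset.sum_congr rfl fun i _ => by ring
  rw [h3, h2]; ring

lemma altChooseSum_one (n : ℕ) : altChooseSum 1 n = powSum 1 n := by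
  induction n with
  | zero => simp [altChooseSum, powSum]
  | succ n ih => rw [altChooseSum_succ, altChooseSum_zero_left, powSum_succ, ih]; ring

lemma altChooseSum_two (n : ℕ) : altChooseSum 2 n = (powSum 1 n ^ 2 + powSum 2 n) / 2 := by
  induction n with
  | zero => simp [altChooseSum, powSum]
  | succ n ih => rw [altChooseSum_succ, altChooseSum_one, powSum_succ, powSum_succ, ih]; ring

lemma altChooseSum_three (n : ℕ) : altChooseSum 3 n =
    (powSum 1 n ^ 3 + 3 * powSum 1 n * powSum 2 n + 2 * powSum 3 n) / 6 := by
  induction n with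
  | zero => simp [altChooseSum, powSum]
  | succ n ih =>
    rw [altChooseSum_succ, altChooseSum_two, powSum_succ, powSum_succ, powSum_succ, ih]; ring

lemma altChooseSum_four (n : ℕ) : altChooseSum 4 n =
    (powSum 1 n ^ 4 + 6 * powSum 1 n ^ 2 * powSum 2 n + 3 * powSum 2 n ^ 2
      + 8 * powSum 1 n * powSum 3 n + 6 * powSum 4 n) / 24 := by
  induction n with
  | zero => simp [altChooseSum, powSum]
  | succ n ih =>
    rw [altChooseSum_succ, altChooseSum_three, powSum_succ, powSum_succ, powSum_succ,
      powSum_succ, ih]; ring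

/-! ### Products replacing the binomial coefficients, and exact identities. -/

/-- The product `∏_{j=1}^{k} (1 - p / j)`. -/
def minusProd (p k : ℕ) : ℚ := ∏ j ∈ Finset.range k, (1 - (p : ℚ) * ((j + 1 : ℕ) : ℚ)⁻¹)

/-- The product `∏_{j=1}^{k} (1 - p ^ 2 / j ^ 2)`. -/
def sqProd (p k : ℕ) : ℚ :=
  ∏ j ∈ Finset.range k, (1 - (p : ℚ) ^ 2 * (((j + 1 : ℕ) : ℚ)⁻¹) ^ 2)

lemma minusProd_succ (p k : ℕ) :
    minusProd p (k + 1) = minusProd p k * (1 - (p : ℚ) * ((k + 1 : ℕ) : ℚ)⁻¹) :=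
  Finset.prod_range_succ _ _

lemma sqProd_succ (p k : ℕ) :
    sqProd p (k + 1) = sqProd p k * (1 - (p : ℚ) ^ 2 * (((k + 1 : ℕ) : ℚ)⁻¹) ^ 2) :=
  Finset.prod_range_succ _ _

lemma minusProd_eq_choose {p k : ℕ} (hk : k ≤ p - 1) (hp : 0 < p) :
    minusProd p k = (-1) ^ k * ((p - 1).choose k : ℚ) := by
  induction k with
  | zero => simp [minusProd]
  | succ k ih =>
    rw [minusProd_succ, ih (by omega)]
    have h := Nat.choose_succ_right_eq (p - 1) k
    have h' : ((p - 1).choose (k + 1) : ℚ) * ((k + 1 : ℕ) : ℚ)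
        = ((p - 1).choose k : ℚ) * ((p : ℚ) - ((k + 1 : ℕ) : ℚ)) := by
      rw [← Nat.cast_sub (by omega), show p - (k + 1) = p - 1 - k by omega]
      exact_mod_cast h
    have h5 : ((k + 1 : ℕ) : ℚ) ≠ 0 := by positivity
    rw [pow_succ]
    field_simp
    linear_combination h'

lemma choose_eq_mul_minusProd {p i : ℕ} (hi : i < p) :
    (p.choose (i + 1) : ℚ) = (-1) ^ i * p * ((i + 1 : ℕ) : ℚ)⁻¹ * minusProd p i := by
  rw [minusProd_eq_choose (by omega) (by omega)]
  have h := Nat.add_one_mul_choose_eq (p - 1) i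
  rw [show p - 1 + 1 = p by omega] at h
  have h' : (p : ℚ) * ((p - 1).choose i : ℚ) = (p.choose (i + 1) : ℚ) * ((i + 1 : ℕ) : ℚ) := by
    exact_mod_cast h
  have h5 : ((i + 1 : ℕ) : ℚ) ≠ 0 := by positivity
  have h6 : ((-1 : ℚ) ^ i) * (-1) ^ i = 1 := by rw [← mul_pow]; simp
  field_simp
  linear_combination (-(p : ℚ) * ((p - 1).choose i : ℚ)) * h6 - h'

lemma choose_eq_minusProd_sqProd {p i : ℕ} (hi : i < p) :
    minusProd p i * ((p + (i + 1) - 1).choose (i + 1 - 1) : ℚ) = sqProd p i := by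
  induction i with
  | zero => simp [minusProd, sqProd]
  | succ i ih =>
    have ih := ih (by omega)
    rw [show p + (i + 1) - 1 = p + i by omega, show i + 1 - 1 = i by omega] at ih
    rw [show p + (i + 1 + 1) - 1 = p + i + 1 by omega, show i + 1 + 1 - 1 = i + 1 by omega,
      minusProd_succ, sqProd_succ, ← ih]
    have h : (((p + i + 1 : ℕ)) : ℚ) * ((p + i).choose i : ℚ)
        = ((p + i + 1).choose (i + 1) : ℚ) * ((i + 1 : ℕ) : ℚ) := by
      exact_mod_cast Nat.add_one_mul_choose_eq (p + i) i
    have h5 : ((i + 1 : ℕ) : ℚ) ≠ 0 := by positivity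
    have h6 : ((p + i + 1).choose (i + 1) : ℚ) =
        (1 + p * ((i + 1 : ℕ) : ℚ)⁻¹) * ((p + i).choose i : ℚ) := by
      field_simp
      push_cast at h ⊢
      linear_combination -h
    rw [h6]; ring

/-- The sum `∑_{k=1}^{p-1} (1 / k ^ m) ∏_{j<k} (1 - p / j)`. -/
def minusProdSum (p m : ℕ) : ℚ :=
  ∑ i ∈ Finset.range (p - 1), minusProd p i * (((i + 1 : ℕ) : ℚ)⁻¹) ^ m

/-- The sum `∑_{k=1}^{p-1} (1 / k ^ m) ∏_{j<k} (1 - p / j) ^ 2 (1 + p / j)`. -/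
def mixedProdSum (p m : ℕ) : ℚ :=
  ∑ i ∈ Finset.range (p - 1), minusProd p i * sqProd p i * (((i + 1 : ℕ) : ℚ)⁻¹) ^ m

/-- The last summand, k = p, is p^(-m), with sign (-1)^(p-1) = 1. It cancels against the j = p terms
of the closed form, which yields exact values of `minusProdSum`. -/
lemma altChooseSum_prime {p m : ℕ} (hp : p.Prime) (hp2 : p ≠ 2) :
    altChooseSum m p = p * minusProdSum p (m + 1) + ((p : ℚ)⁻¹) ^ m := by
  obtain ⟨n, rfl⟩ : ∃ n, p = n + 1 := ⟨p - 1, by have := hp.pos; omega⟩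
  have hev : Even n := by
    rcases hp.eq_two_or_odd' with h | h
    · exact absurd h hp2
    · rcases h with ⟨k, hk⟩; exact ⟨k, by omega⟩
  rw [altChooseSum, Finset.sum_range_succ, minusProdSum, Finset.mul_sum]
  congr 1
  · rw [show n + 1 - 1 = n by omega]
    refine Finset.sum_congr rfl fun i hi => ?_
    have hi' : i < n := by simpa using hi
    rw [choose_eq_mul_minusProd (by omega : i < n + 1)]
    have h6 : ((-1 : ℚ) ^ i) * (-1) ^ i = 1 := by rw [← mul_pow]; simp
    rw [pow_succ]
    linear_combination (((n + 1 : ℕ) : ℚ) * ((i + 1 : ℕ) : ℚ)⁻¹ * minusProd (n + 1) i *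
      (((i + 1 : ℕ) : ℚ)⁻¹) ^ m) * h6
  · rw [hev.neg_one_pow]; simp

lemma minusProdSum_two {p : ℕ} (hp : p.Prime) (hp2 : p ≠ 2) :
    (p : ℚ) * minusProdSum p 2 = powSum 1 (p - 1) := by
  have h := altChooseSum_prime (m := 1) hp hp2
  obtain ⟨n, rfl⟩ : ∃ n, p = n + 1 := ⟨p - 1, by have := hp.pos; omega⟩
  rw [altChooseSum_one, powSum_succ] at h
  simp only [Nat.add_sub_cancel]
  linear_combination -h

lemma minusProdSum_three {p : ℕ} (hp : p.Prime) (hp2 : p ≠ 2) :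
    2 * (p : ℚ) ^ 2 * minusProdSum p 3 =
      p * powSum 1 (p - 1) ^ 2 + 2 * powSum 1 (p - 1) + p * powSum 2 (p - 1) := by
  have h := altChooseSum_prime (m := 2) hp hp2
  obtain ⟨n, rfl⟩ : ∃ n, p = n + 1 := ⟨p - 1, by have := hp.pos; omega⟩
  rw [altChooseSum_two, powSum_succ, powSum_succ] at h
  simp only [Nat.add_sub_cancel]
  have h4 : ((n + 1 : ℕ) : ℚ) ≠ 0 := by positivity
  field_simp at h
  apply mul_left_cancel₀ h4
  linear_combination -h

/-- The squared binomial contributes two copies of `minusProd`; the third binomial, ∏(1 + p/j),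
turns one of them into `sqProd`. -/
lemma binomSum_eq_sum (p r : ℕ) :
    (binomSum p r : ℚ) = ∑ i ∈ Finset.range (p - 1), (p : ℚ) ^ 2 * (minusProd p i * sqProd p i *
      (((i + 1 : ℕ) : ℚ)⁻¹) ^ 2 * ((i + 1 : ℕ) : ℚ) ^ r) := by
  have h1 : binomSum p r = ∑ i ∈ Finset.range (p - 1),
      p.choose (i + 1) ^ 2 * (p + (i + 1) - 1).choose (i + 1 - 1) * (i + 1) ^ r := by
    rw [binomSum, Finset.range_eq_Ico,
      Finset.sum_Ico_add' (fun k => p.choose k ^ 2 * (p + k - 1).choose (k - 1) * k ^ r)]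
    rfl
  rw [h1, Nat.cast_sum]
  refine Finset.sum_congr rfl fun i hi => ?_
  have hi' : i < p := by simp at hi; omega
  have h := choose_eq_minusProd_sqProd hi'
  have h6 : ((-1 : ℚ) ^ i) * (-1) ^ i = 1 := by rw [← mul_pow]; simp
  simp only [Nat.cast_mul, Nat.cast_pow]
  rw [choose_eq_mul_minusProd hi', ← h]
  generalize ((p + (i + 1) - 1).choose (i + 1 - 1) : ℚ) = c
  generalize (((i + 1 : ℕ) : ℚ)⁻¹) = x
  linear_combination ((p : ℚ) ^ 2 * x ^ 2 * minusProd p i ^ 2 *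
    c * ((i + 1 : ℕ) : ℚ) ^ r) * h6

lemma binomSum_zero (p : ℕ) : (binomSum p 0 : ℚ) = (p : ℚ) ^ 2 * mixedProdSum p 2 := by
  rw [binomSum_eq_sum, mixedProdSum, Finset.mul_sum]
  refine Finset.sum_congr rfl fun i _ => by ring

lemma binomSum_one (p : ℕ) : (binomSum p 1 : ℚ) = (p : ℚ) ^ 2 * mixedProdSum p 1 := by
  rw [binomSum_eq_sum, mixedProdSum, Finset.mul_sum]
  refine Finset.sum_congr rfl fun i _ => ?_
  have h5 : ((i + 1 : ℕ) : ℚ) ≠ 0 := by positivity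
  field_simp

lemma binomSum_two (p : ℕ) : (binomSum p 2 : ℚ) = (p : ℚ) ^ 2 * mixedProdSum p 0 := by
  rw [binomSum_eq_sum, mixedProdSum, Finset.mul_sum]
  refine Finset.sum_congr rfl fun i _ => ?_
  have h5 : ((i + 1 : ℕ) : ℚ) ≠ 0 := by positivity
  field_simp

lemma minusProd_prime {p : ℕ} (hp : p.Prime) (hp2 : p ≠ 2) : minusProd p (p - 1) = 1 := by
  have hev : Even (p - 1) := hp.even_sub_one hp2
  rw [minusProd_eq_choose le_rfl hp.pos, hev.neg_one_pow]; simp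

/-- Telescoping: the bracket is (1 - px)(1 - p²x²) - 1 with x = 1/(i+1). -/
lemma minusProd_mul_sqProd_sub_one (p n : ℕ) :
    minusProd p n * sqProd p n - 1 = ∑ i ∈ Finset.range n, minusProd p i * sqProd p i *
      (-(p : ℚ) * ((i + 1 : ℕ) : ℚ)⁻¹ - (p : ℚ) ^ 2 * (((i + 1 : ℕ) : ℚ)⁻¹) ^ 2
        + (p : ℚ) ^ 3 * (((i + 1 : ℕ) : ℚ)⁻¹) ^ 3) := by
  induction n with
  | zero => simp [minusProd, sqProd]
  | succ n ih => rw [Finset.sum_range_succ, ← ih, minusProd_succ, sqProd_succ]; ring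

lemma mixedProdSum_relation {p : ℕ} (hp : p.Prime) (hp2 : p ≠ 2) :
    sqProd p (p - 1) = 1 - (p : ℚ) * mixedProdSum p 1 - (p : ℚ) ^ 2 * mixedProdSum p 2
      + (p : ℚ) ^ 3 * mixedProdSum p 3 := by
  have h := minusProd_mul_sqProd_sub_one p (p - 1)
  rw [minusProd_prime hp hp2, one_mul] at h
  rw [mixedProdSum, mixedProdSum, mixedProdSum, sub_eq_iff_eq_add.1 h, Finset.mul_sum,
    Finset.mul_sum, Finset.mul_sum, sub_sub, ← Finset.sum_add_distrib, sub_add,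
    ← Finset.sum_sub_distrib]
  rw [sub_eq_add_neg, ← Finset.sum_neg_distrib, add_comm]
  congr 1
  refine Finset.sum_congr rfl fun i _ => by ring

/-- Telescoping with the extra weight n, which brings in the exponent-0 sum. -/
lemma nat_mul_minusProd_mul_sqProd (p n : ℕ) :
    (n : ℚ) * (minusProd p n * sqProd p n) = ∑ i ∈ Finset.range n, minusProd p i * sqProd p i *
      ((1 - (p : ℚ)) - (p : ℚ) ^ 2 * ((i + 1 : ℕ) : ℚ)⁻¹
        + (p : ℚ) ^ 3 * (((i + 1 : ℕ) : ℚ)⁻¹) ^ 2) := by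
  induction n with
  | zero => simp
  | succ n ih =>
    rw [Finset.sum_range_succ, ← ih, minusProd_succ, sqProd_succ]
    have h5 : ((n + 1 : ℕ) : ℚ) ≠ 0 := by positivity
    have h6 : (n : ℚ) = ((n + 1 : ℕ) : ℚ) - 1 := by push_cast; ring
    rw [h6]
    field_simp
    ring

lemma mixedProdSum_zero_relation {p : ℕ} (hp : p.Prime) (hp2 : p ≠ 2) :
    ((p : ℚ) - 1) * mixedProdSum p 0 = (p : ℚ) ^ 3 * mixedProdSum p 2
      - (p : ℚ) ^ 2 * mixedProdSum p 1 - ((p : ℚ) - 1) * sqProd p (p - 1) := by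
  have h := nat_mul_minusProd_mul_sqProd p (p - 1)
  rw [minusProd_prime hp hp2, one_mul, Nat.cast_sub hp.one_le, Nat.cast_one] at h
  rw [h, mixedProdSum, mixedProdSum, mixedProdSum, Finset.mul_sum,
    Finset.mul_sum, Finset.mul_sum, ← Finset.sum_sub_distrib, ← Finset.sum_sub_distrib]
  refine Finset.sum_congr rfl fun i _ => by ring

/-! ### Expansions in powers of p. -/

lemma five_lt_sub_one {p : ℕ} (hp : p.Prime) (hp5 : 5 < p) : 5 < p - 1 := by
  have : p ≠ 6 := by rintro rfl; revert hp; decide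
  omega

/-- A common denominator for every rational constant below: 60 stands for 1/2, 30 for 1/4, 5 for
1/24, 96 for 4/5, and so on. -/
lemma PDvd.div_120 {p : ℕ} (hp : p.Prime) (hp5 : 5 < p) (a : ℤ) : PDvd p 0 ((a : ℚ) / 120) := by
  have h : ¬ p ∣ 120 := by
    rw [show 120 = Nat.factorial 5 by rfl, hp.dvd_factorial]; omega
  have h1 : PDvd p 0 (a : ℚ) := ⟨a, by simp, by simp⟩
  have := h1.mul_right (PDvd.inv_natCast hp h)
  simpa [div_eq_mul_inv] using this

lemma minusProd_pDvd {p k : ℕ} (hp : p.Prime) (hk : k ≤ p - 1) :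
    PDvd p 2 (minusProd p k - (1 - (p : ℚ) * powSum 1 k)) := by
  induction k with
  | zero => simpa [minusProd, powSum] using PDvd.zero
  | succ k ih =>
    have hx := PDvd.inv_succ hp (show k < p - 1 by omega)
    have hX := PDvd.powSum hp 1 (show k ≤ p - 1 by omega)
    rw [minusProd_succ, powSum_succ]
    have h1 : PDvd p 0 (1 - (p : ℚ) * ((k + 1 : ℕ) : ℚ)⁻¹) :=
      PDvd.one.sub (PDvd.mul_left (PDvd.natCast p) hx)
    have e := ((ih (by omega)).mul_right h1).add (PDvd.pow_mul 2 (hX.mul_left hx))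
    convert e using 1
    ring

lemma minusProd_pDvd_zero {p k : ℕ} (hp : p.Prime) (hk : k ≤ p - 1) :
    PDvd p 0 (minusProd p k) := by
  have h := ((minusProd_pDvd hp hk).mono (Nat.zero_le 2)).add (PDvd.one.sub
    (PDvd.mul_left (PDvd.natCast p) (PDvd.powSum hp 1 hk)))
  simpa using h

lemma minusProd_sub_one_pDvd {p k : ℕ} (hp : p.Prime) (hk : k ≤ p - 1) :
    PDvd p 1 (minusProd p k - 1) := by
  have h := ((minusProd_pDvd hp hk).mono (show 1 ≤ 2 by omega)).sub
    (PDvd.pow_mul 1 (PDvd.powSum hp 1 hk))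
  convert h using 1
  ring

lemma sqProd_pDvd {p k : ℕ} (hp : p.Prime) (hp5 : 5 < p) (hk : k ≤ p - 1) :
    PDvd p 6 (sqProd p k - (1 - (p : ℚ) ^ 2 * powSum 2 k
      + (p : ℚ) ^ 4 * ((powSum 2 k ^ 2 - powSum 4 k) / 2))) := by
  induction k with
  | zero => simpa [sqProd, powSum] using PDvd.zero
  | succ k ih =>
    have hx := PDvd.inv_succ hp (show k < p - 1 by omega)
    have hY := PDvd.powSum hp 2 (show k ≤ p - 1 by omega)
    have hZ := PDvd.powSum hp 4 (show k ≤ p - 1 by omega)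
    rw [sqProd_succ, powSum_succ, powSum_succ]
    have h1 : PDvd p 0 (1 - (p : ℚ) ^ 2 * (((k + 1 : ℕ) : ℚ)⁻¹) ^ 2) :=
      PDvd.one.sub (PDvd.mul_left ((PDvd.natCast p).pow 2) (hx.pow 2))
    have h2 := (PDvd.div_120 hp hp5 60).mul_left (((hY.pow 2).sub hZ).mul_left (hx.pow 2))
    have e := ((ih (by omega)).mul_right h1).sub (PDvd.pow_mul 6 h2)
    convert e using 1
    push_cast
    ring

lemma sqProd_sub_pDvd {p k : ℕ} (hp : p.Prime) (hp5 : 5 < p) (hk : k ≤ p - 1) :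
    PDvd p 4 (sqProd p k - (1 - (p : ℚ) ^ 2 * powSum 2 k)) := by
  have hY := PDvd.powSum hp 2 hk
  have hZ := PDvd.powSum hp 4 hk
  have h := ((sqProd_pDvd hp hp5 hk).mono (show 4 ≤ 6 by omega)).add
    (PDvd.pow_mul 4 ((PDvd.div_120 hp hp5 60).mul_left ((hY.pow 2).sub hZ)))
  convert h using 1
  push_cast
  ring

/-- `minusProd` stays unexpanded in the leading term, since that sum is known exactly; in the p²
term its expansion modulo p² is enough. -/
lemma mixedProdSum_two_pDvd {p : ℕ} (hp : p.Prime) (hp5 : 5 < p) :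
    PDvd p 4 (mixedProdSum p 2 - (minusProdSum p 2 - (p : ℚ) ^ 2 * doubleSum 2 2 (p - 1)
      + (p : ℚ) ^ 3 * ∑ i ∈ Finset.range (p - 1),
        powSum 1 i * powSum 2 i * (((i + 1 : ℕ) : ℚ)⁻¹) ^ 2)) := by
  have h : PDvd p 4 (∑ i ∈ Finset.range (p - 1), (minusProd p i *
      ((sqProd p i - (1 - (p : ℚ) ^ 2 * powSum 2 i)) * (((i + 1 : ℕ) : ℚ)⁻¹) ^ 2) -
      (p : ℚ) ^ 2 * ((minusProd p i - (1 - (p : ℚ) * powSum 1 i)) *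
        (powSum 2 i * (((i + 1 : ℕ) : ℚ)⁻¹) ^ 2)))) := by
    refine PDvd.sum fun i hi => ?_
    have hi : i < p - 1 := by simpa using hi
    have hx := (PDvd.inv_succ hp hi).pow 2
    exact ((minusProd_pDvd_zero hp hi.le).mul_left ((sqProd_sub_pDvd hp hp5 hi.le).mul_right hx)).sub
      (PDvd.pow_mul 2 ((minusProd_pDvd hp hi.le).mul_right
        ((PDvd.powSum hp 2 hi.le).mul_left hx)))
  convert h using 1
  rw [mixedProdSum, minusProdSum, doubleSum, Finset.mul_sum, Finset.mul_sum,
    ← Finset.sum_sub_distrib, ← Finset.sum_add_distrib, ← Finset.sum_sub_distrib]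
  refine Finset.sum_congr rfl fun i _ => by ring

lemma mixedProdSum_three_pDvd {p : ℕ} (hp : p.Prime) (hp5 : 5 < p) :
    PDvd p 3 (mixedProdSum p 3 - (minusProdSum p 3 - (p : ℚ) ^ 2 * doubleSum 2 3 (p - 1))) := by
  have h : PDvd p 3 (∑ i ∈ Finset.range (p - 1), (minusProd p i *
      ((sqProd p i - (1 - (p : ℚ) ^ 2 * powSum 2 i)) * (((i + 1 : ℕ) : ℚ)⁻¹) ^ 3) -
      (p : ℚ) ^ 2 * ((minusProd p i - 1) *
        (powSum 2 i * (((i + 1 : ℕ) : ℚ)⁻¹) ^ 3)))) := by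
    refine PDvd.sum fun i hi => ?_
    have hi : i < p - 1 := by simpa using hi
    have hx := (PDvd.inv_succ hp hi).pow 3
    exact (((minusProd_pDvd_zero hp hi.le).mul_left
      ((sqProd_sub_pDvd hp hp5 hi.le).mul_right hx)).mono (by omega)).sub
      (PDvd.pow_mul 2 ((minusProd_sub_one_pDvd hp hi.le).mul_right
        ((PDvd.powSum hp 2 hi.le).mul_left hx)))
  convert h using 1
  rw [mixedProdSum, minusProdSum, doubleSum, Finset.mul_sum,
    ← Finset.sum_sub_distrib, ← Finset.sum_sub_distrib]
  refine Finset.sum_congr rfl fun i _ => by ring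

/-! ### Reflection k ↦ p - k. -/

/-- The reflection `k ↦ p - k` on reciprocals. -/
lemma inv_reflect {p i : ℕ} (hi : i < p - 1) :
    ((p - 1 - 1 - i + 1 : ℕ) : ℚ)⁻¹ = -((i + 1 : ℕ) : ℚ)⁻¹
      + p * ((i + 1 : ℕ) : ℚ)⁻¹ * ((p - 1 - 1 - i + 1 : ℕ) : ℚ)⁻¹ := by
  have h : (p : ℚ) = ((p - 1 - 1 - i + 1 : ℕ) : ℚ) + ((i + 1 : ℕ) : ℚ) := by
    rw [← Nat.cast_add]; congr 1; omega
  rw [h]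
  have h1 : ((p - 1 - 1 - i + 1 : ℕ) : ℚ) ≠ 0 := by positivity
  have h2 : ((i + 1 : ℕ) : ℚ) ≠ 0 := by positivity
  field_simp
  ring

lemma powSum_reflect (m p : ℕ) : powSum m (p - 1) =
    ∑ i ∈ Finset.range (p - 1), (((p - 1 - 1 - i + 1 : ℕ) : ℚ)⁻¹) ^ m :=
  (Finset.sum_range_reflect (fun i => (((i + 1 : ℕ) : ℚ)⁻¹) ^ m) (p - 1)).symm

/-- Iterating `inv_reflect` gives 1/(p-k) = -(1/k + p/k² + p²/k³ + ...). The term p^4 P_5 drops out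
because p divides P_5. -/
lemma powSum_one_reflection {p : ℕ} (hp : p.Prime) (hp5 : 5 < p) :
    PDvd p 5 (2 * powSum 1 (p - 1) + p * powSum 2 (p - 1) + (p : ℚ) ^ 2 * powSum 3 (p - 1)
      + (p : ℚ) ^ 3 * powSum 4 (p - 1)) := by
  have h : PDvd p 5 (∑ i ∈ Finset.range (p - 1), (p : ℚ) ^ 5 *
      ((((i + 1 : ℕ) : ℚ)⁻¹) ^ 5 * ((p - 1 - 1 - i + 1 : ℕ) : ℚ)⁻¹)) := by
    refine PDvd.sum fun i hi => ?_
    have hi : i < p - 1 := by simpa using hi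
    exact PDvd.pow_mul 5 (((PDvd.inv_succ hp hi).pow 5).mul_left
      (PDvd.inv_succ hp (by omega)))
  have h5 := PDvd.pow_mul 4 (powSum_pDvd_one hp (show 0 < 5 by omega) (five_lt_sub_one hp hp5))
  convert h.sub h5 using 1
  rw [two_mul]
  nth_rewrite 1 [powSum_reflect 1]
  simp only [powSum]
  rw [Finset.mul_sum, Finset.mul_sum, Finset.mul_sum, Finset.mul_sum, ← Finset.sum_add_distrib,
    ← Finset.sum_add_distrib, ← Finset.sum_add_distrib, ← Finset.sum_add_distrib,
    ← Finset.sum_sub_distrib]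
  refine Finset.sum_congr rfl fun i hi => ?_
  have hr := inv_reflect (show i < p - 1 by simpa using hi)
  generalize ((p - 1 - 1 - i + 1 : ℕ) : ℚ)⁻¹ = y at *
  generalize ((i + 1 : ℕ) : ℚ)⁻¹ = x at *
  linear_combination (1 + p * x + (p * x) ^ 2 + (p * x) ^ 3 + (p * x) ^ 4) * hr

/-- The cube of the same expansion; the next term, 6p² P_5, is divisible by p³. -/
lemma powSum_three_reflection {p : ℕ} (hp : p.Prime) (hp5 : 5 < p) :
    PDvd p 3 (2 * powSum 3 (p - 1) + 3 * p * powSum 4 (p - 1)) := by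
  have h : PDvd p 3 (∑ i ∈ Finset.range (p - 1), (p : ℚ) ^ 3 *
      ((((i + 1 : ℕ) : ℚ)⁻¹) ^ 3 * ((((p - 1 - 1 - i + 1 : ℕ) : ℚ)⁻¹) ^ 3
        - 3 * ((((i + 1 : ℕ) : ℚ)⁻¹) * (((p - 1 - 1 - i + 1 : ℕ) : ℚ)⁻¹) ^ 2)
        + 6 * ((((i + 1 : ℕ) : ℚ)⁻¹) ^ 2 * (((p - 1 - 1 - i + 1 : ℕ) : ℚ)⁻¹))))) := by
    refine PDvd.sum fun i hi => ?_
    have hi : i < p - 1 := by simpa using hi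
    have hx := PDvd.inv_succ hp hi
    have hy := PDvd.inv_succ hp (show p - 1 - 1 - i < p - 1 by omega)
    exact PDvd.pow_mul 3 ((hx.pow 3).mul_left (((hy.pow 3).sub
      ((PDvd.natCast 3).mul_left (hx.mul_left (hy.pow 2)))).add
      ((PDvd.natCast 6).mul_left ((hx.pow 2).mul_left hy))))
  have h5 := (PDvd.natCast 6).mul_left (PDvd.pow_mul 2
    (powSum_pDvd_one hp (show 0 < 5 by omega) (five_lt_sub_one hp hp5)))
  convert h.sub h5 using 1
  rw [two_mul]
  nth_rewrite 1 [powSum_reflect 3]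
  simp only [powSum]
  rw [Finset.mul_sum, Finset.mul_sum, Finset.mul_sum, ← Finset.sum_add_distrib,
    ← Finset.sum_add_distrib, ← Finset.sum_sub_distrib]
  refine Finset.sum_congr rfl fun i hi => ?_
  have hr := inv_reflect (show i < p - 1 by simpa using hi)
  generalize ((p - 1 - 1 - i + 1 : ℕ) : ℚ)⁻¹ = y at *
  generalize ((i + 1 : ℕ) : ℚ)⁻¹ = x at *
  push_cast
  linear_combination (y ^ 2 + p * x * y ^ 2 + p ^ 2 * x ^ 2 * y ^ 2 - 2 * p * x ^ 2 * y - x * y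
    + x ^ 2 - 3 * p ^ 2 * x ^ 3 * y + 3 * p * x ^ 3 + 6 * p ^ 2 * x ^ 4) * hr

lemma powSum_one_pDvd_two {p : ℕ} (hp : p.Prime) (hp5 : 5 < p) :
    PDvd p 2 (powSum 1 (p - 1)) := by
  have h2 := PDvd.pow_mul 1 (powSum_pDvd_one hp (show 0 < 2 by omega) (by omega))
  have h3 := PDvd.pow_mul 2 (PDvd.powSum hp 3 le_rfl)
  have h4 := PDvd.pow_mul 3 (PDvd.powSum hp 4 le_rfl)
  have h := (((powSum_one_reflection hp hp5).mono (show 2 ≤ 5 by omega)).sub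
    ((h2.add h3).add (h4.mono (by omega))))
  have := (PDvd.div_120 hp hp5 60).mul_left h
  convert this using 1
  push_cast
  ring

lemma powSum_two_reflect {p i : ℕ} (hp : p.Prime) (hp5 : 5 < p) (hi : i ≤ p - 1) :
    PDvd p 1 (powSum 2 (p - 1 - i) + powSum 2 i) := by
  induction i with
  | zero => simpa [powSum_zero_right] using powSum_pDvd_one hp (show 0 < 2 by omega) (by omega)
  | succ i ih =>
    have ih := ih (by omega)
    have hx := PDvd.inv_succ hp (show i < p - 1 by omega)
    have hy := PDvd.inv_succ hp (show p - 1 - 1 - i < p - 1 by omega)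
    have hr := inv_reflect (show i < p - 1 by omega)
    rw [show p - 1 - i = p - 1 - 1 - i + 1 by omega, powSum_succ] at ih
    rw [show p - 1 - (i + 1) = p - 1 - 1 - i by omega, powSum_succ]
    have h := ih.sub (PDvd.pow_mul 1 ((hx.mul_left hy).mul_left (hy.sub hx)))
    convert h using 1
    generalize ((p - 1 - 1 - i + 1 : ℕ) : ℚ)⁻¹ = y at *
    generalize ((i + 1 : ℕ) : ℚ)⁻¹ = x at *
    linear_combination (x - y) * hr

/-! ### Sums of weight 5 modulo p. -/

/-- Summation by parts applied to `powSum 1 n * powSum 2 n ^ 2`. -/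
lemma sum_abel (n : ℕ) : 2 * (∑ i ∈ Finset.range n,
      powSum 1 i * powSum 2 i * (((i + 1 : ℕ) : ℚ)⁻¹) ^ 2) + doubleSum 1 4 n
      + ∑ i ∈ Finset.range n, ((i + 1 : ℕ) : ℚ)⁻¹ * powSum 2 (i + 1) ^ 2
      = powSum 1 n * powSum 2 n ^ 2 := by
  induction n with
  | zero => simp [doubleSum, powSum]
  | succ n ih =>
    have h : doubleSum 1 4 (n + 1) =
        doubleSum 1 4 n + powSum 1 n * (((n + 1 : ℕ) : ℚ)⁻¹) ^ 4 := by
      simp [doubleSum, Finset.sum_range_succ]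
    rw [Finset.sum_range_succ, Finset.sum_range_succ, h, powSum_succ, powSum_succ]
    linear_combination ih

lemma sum_inv_mul_powSum_sq (n : ℕ) :
    ∑ i ∈ Finset.range n, ((i + 1 : ℕ) : ℚ)⁻¹ * powSum 2 (i + 1) ^ 2 =
      ∑ i ∈ Finset.range n, ((i + 1 : ℕ) : ℚ)⁻¹ * powSum 2 i ^ 2 + 2 * doubleSum 2 3 n
        + powSum 5 n := by
  rw [doubleSum, powSum, Finset.mul_sum, ← Finset.sum_add_distrib, ← Finset.sum_add_distrib]
  refine Finset.sum_congr rfl fun i _ => ?_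
  rw [powSum_succ]; ring

/-- Reflection flips the sign of 1/k and exchanges the squares of the partial sums up to k - 1 and
up to k, modulo p. -/
lemma sum_inv_mul_powSum_sq_reflect {p : ℕ} (hp : p.Prime) (hp5 : 5 < p) :
    PDvd p 1 (∑ i ∈ Finset.range (p - 1), ((i + 1 : ℕ) : ℚ)⁻¹ * powSum 2 i ^ 2 +
      ∑ i ∈ Finset.range (p - 1), ((i + 1 : ℕ) : ℚ)⁻¹ * powSum 2 (i + 1) ^ 2) := by
  rw [← Finset.sum_range_reflect (fun i => ((i + 1 : ℕ) : ℚ)⁻¹ * powSum 2 i ^ 2),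
    ← Finset.sum_add_distrib]
  refine PDvd.sum fun i hi => ?_
  have hi : i < p - 1 := by simpa using hi
  have hx := PDvd.inv_succ hp hi
  have hy := PDvd.inv_succ hp (show p - 1 - 1 - i < p - 1 by omega)
  have hr := inv_reflect hi
  have hY := powSum_two_reflect hp hp5 (show i + 1 ≤ p - 1 by omega)
  rw [show p - 1 - (i + 1) = p - 1 - 1 - i by omega] at hY
  have h1 := PDvd.powSum hp 2 (show i + 1 ≤ p - 1 by omega)
  have h2 := PDvd.powSum hp 2 (show p - 1 - 1 - i ≤ p - 1 by omega)
  have h := (PDvd.pow_mul 1 ((hx.mul_left hy).mul_left (h1.pow 2))).add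
    ((hY.mul_right (h2.sub h1)).mul_right hy)
  convert h using 1
  linear_combination powSum 2 (i + 1) ^ 2 * hr

lemma sum_powSum_mul_pDvd {p : ℕ} (hp : p.Prime) (hp5 : 5 < p) :
    PDvd p 1 (2 * (∑ i ∈ Finset.range (p - 1),
      powSum 1 i * powSum 2 i * (((i + 1 : ℕ) : ℚ)⁻¹) ^ 2) + doubleSum 1 4 (p - 1)
      + doubleSum 2 3 (p - 1)) := by
  have h1 := sum_abel (p - 1)
  have h2 := sum_inv_mul_powSum_sq (p - 1)
  have h3 := sum_inv_mul_powSum_sq_reflect hp hp5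
  have h5 := powSum_pDvd_one hp (show 0 < 5 by omega) (five_lt_sub_one hp hp5)
  have h6 := (powSum_pDvd_one hp (show 0 < 1 by omega) (show 1 < p - 1 by omega)).mul_right
    ((PDvd.powSum hp 2 (le_refl (p - 1))).pow 2)
  have h := (h6.sub ((PDvd.div_120 hp hp5 60).mul_left h3)).sub
    ((PDvd.div_120 hp hp5 60).mul_left h5)
  convert h using 1
  simp only [Int.cast_ofNat]
  linear_combination h1 - (1 / 2) * h2

/-- Fermat makes the exponents positive and Faulhaber's formula evaluates the inner sum. Modulo p,
only the outer power sum with exponent p - 1 survives, equal to -1; this is the Bernoulli index t =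
p - 5. -/
lemma doubleSum_pDvd {p a b : ℕ} (hp : p.Prime) (hp5 : 5 < p) (hab : a + b = 5)
    (ha : 0 < a) (hb : 0 < b) :
    PDvd p 1 (doubleSum a b (p - 1) +
      bernoulli (p - 5) * ((p - a).choose (p - 5) : ℚ) / ((p - a : ℕ) : ℚ)) := by
  have h1 : PDvd p 1 (doubleSum a b (p - 1) - ∑ i ∈ Finset.range (p - 1),
      (∑ j ∈ Finset.range i, ((j + 1 : ℕ) : ℚ) ^ (p - 1 - a)) *
        ((i + 1 : ℕ) : ℚ) ^ (p - 1 - b)) := by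
    rw [doubleSum, ← Finset.sum_sub_distrib]
    refine PDvd.sum fun i hi => ?_
    have hi : i < p - 1 := by simpa using hi
    have h2 : PDvd p 1 (powSum a i - ∑ j ∈ Finset.range i, ((j + 1 : ℕ) : ℚ) ^ (p - 1 - a)) := by
      rw [powSum, ← Finset.sum_sub_distrib]
      exact PDvd.sum fun j hj =>
        inv_pow_sub_pow_pDvd hp (by simp at hj; omega) (by omega)
    have h3 := inv_pow_sub_pow_pDvd hp hi (show b ≤ p - 1 by omega)
    have h := (h2.mul_right ((PDvd.natCast (i + 1)).pow (p - 1 - b))).add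
      ((PDvd.powSum hp a hi.le).mul_left h3)
    convert h using 1
    ring
  have h2 : ∑ i ∈ Finset.range (p - 1),
      (∑ j ∈ Finset.range i, ((j + 1 : ℕ) : ℚ) ^ (p - 1 - a)) *
        ((i + 1 : ℕ) : ℚ) ^ (p - 1 - b) =
      ∑ t ∈ Finset.range (p - a), bernoulli t * ((p - a).choose t : ℚ) / ((p - a : ℕ) : ℚ) *
        ∑ i ∈ Finset.range (p - 1), ((i + 1 : ℕ) : ℚ) ^ (2 * p - 6 - t) := by
    have h3 (i : ℕ) : ∑ j ∈ Finset.range i, ((j + 1 : ℕ) : ℚ) ^ (p - 1 - a) =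
        ∑ t ∈ Finset.range (p - a), bernoulli t * ((p - a).choose t : ℚ) *
          ((i + 1 : ℕ) : ℚ) ^ (p - a - t) / ((p - a : ℕ) : ℚ) := by
      have h := sum_range_pow (i + 1) (p - 1 - a)
      rw [Finset.sum_range_succ', show p - 1 - a + 1 = p - a by omega] at h
      rw [Nat.cast_zero, zero_pow (by omega), add_zero] at h
      rw [h]
      refine Finset.sum_congr rfl fun t _ => ?_
      have : ((p - 1 - a : ℕ) : ℚ) + 1 = ((p - a : ℕ) : ℚ) := by
        rw [← Nat.cast_add_one]; congr 1; omega
      rw [this]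
    simp_rw [h3, Finset.sum_mul, Finset.mul_sum]
    rw [Finset.sum_comm]
    refine Finset.sum_congr rfl fun t ht => Finset.sum_congr rfl fun i _ => ?_
    have ht : t < p - a := by simpa using ht
    rw [show 2 * p - 6 - t = (p - a - t) + (p - 1 - b) by omega, pow_add]
    ring
  have hcoef (t : ℕ) (ht : t < p - a) :
      PDvd p 0 (bernoulli t * ((p - a).choose t : ℚ) / ((p - a : ℕ) : ℚ)) := by
    rw [div_eq_mul_inv]
    exact ((bernoulli_pDvd_zero hp (by omega)).mul_right (PDvd.natCast _)).mul_right
      (PDvd.inv_of_lt hp (by omega) (by omega))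
  have hfer : PDvd p 1 (1 + ∑ i ∈ Finset.range (p - 1), ((i + 1 : ℕ) : ℚ) ^ (p - 1)) := by
    have h := PDvd.sum (s := Finset.range (p - 1)) (fun i hi =>
      inv_pow_sub_pow_pDvd hp (i := i) (m := 0) (by simpa using hi) (Nat.zero_le _))
    have hpp : PDvd p 1 (p : ℚ) := by simpa using PDvd.self_pow (p := p) (n := 1)
    convert hpp.sub h using 1
    simp [Nat.cast_sub hp.one_le]
    ring
  rw [h2] at h1
  have hmem : p - 5 ∈ Finset.range (p - a) := by simp; omega
  rw [← Finset.add_sum_erase _ _ hmem, show 2 * p - 6 - (p - 5) = p - 1 by omega] at h1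
  have h4 : PDvd p 1 (∑ t ∈ (Finset.range (p - a)).erase (p - 5),
      bernoulli t * ((p - a).choose t : ℚ) / ((p - a : ℕ) : ℚ) *
        ∑ i ∈ Finset.range (p - 1), ((i + 1 : ℕ) : ℚ) ^ (2 * p - 6 - t)) := by
    refine PDvd.sum fun t ht => ?_
    simp only [Finset.mem_erase, Finset.mem_range] at ht
    refine (hcoef t ht.2).mul_left (sum_pow_pDvd hp ?_)
    rintro ⟨c, hc⟩
    -- The exponent is positive and less than 2(p - 1), so it can only equal p - 1, which is the
    -- erased index.
    have h7 : c < 2 := by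
      by_contra hcon
      have : (p - 1) * 2 ≤ (p - 1) * c := Nat.mul_le_mul_left _ (by omega)
      omega
    interval_cases c <;> omega
  have h := (h1.add h4).add ((hcoef (p - 5) (by omega)).mul_left hfer)
  convert h using 1
  ring

lemma doubleSum_one_four_pDvd {p : ℕ} (hp : p.Prime) (hp5 : 5 < p) :
    PDvd p 1 (doubleSum 1 4 (p - 1) - bernoulli (p - 5)) := by
  have h := doubleSum_pDvd hp hp5 (show 1 + 4 = 5 by rfl) (by omega) (by omega)
  have hB := bernoulli_pDvd_zero hp (show p - 5 < p - 1 by omega)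
  have hpp := PDvd.natCast (p := p) p
  -- The coefficient is (p-2)(p-3)(p-4)/24 = -1 + p(p² - 9p + 26)/24.
  have hq := PDvd.pow_mul 1 (hB.mul_left ((PDvd.div_120 hp hp5 5).mul_left
    (((hpp.pow 2).sub ((PDvd.natCast 9).mul_left hpp)).add (PDvd.natCast 26))))
  convert h.sub hq using 1
  obtain ⟨q, rfl⟩ : ∃ q, p = q + 5 := ⟨p - 5, by omega⟩
  have hc : ((q + 4).choose q : ℚ) = (q + 4) * (q + 3) * (q + 2) * (q + 1) / 24 := by
    have h1 : (q + 4).choose q = (q + 4).choose 4 := Nat.choose_symm_add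
    have h2 := Nat.descFactorial_eq_factorial_mul_choose (q + 4) 4
    rw [h1]
    have h3 : (((q + 4).descFactorial 4 : ℕ) : ℚ) = (q + 4) * (q + 3) * (q + 2) * (q + 1) := by
      simp [Nat.descFactorial]; ring
    rw [h2] at h3
    rw [← h3]; simp [Nat.factorial]
  rw [show q + 5 - 1 = q + 4 by omega, show q + 5 - 5 = q by omega, hc]
  have h5 : (q : ℚ) + 4 ≠ 0 := by positivity
  push_cast
  field_simp
  ring

lemma doubleSum_two_three_pDvd {p : ℕ} (hp : p.Prime) (hp5 : 5 < p) :
    PDvd p 1 (doubleSum 2 3 (p - 1) + 2 * bernoulli (p - 5)) := by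
  have h := doubleSum_pDvd hp hp5 (show 3 + 2 = 5 by rfl) (by omega) (by omega)
  have hB := bernoulli_pDvd_zero hp (show p - 5 < p - 1 by omega)
  -- For a = 3 the coefficient is (p-4)/2 = -2 + p/2.
  have hq := PDvd.pow_mul 1 (hB.mul_left (PDvd.div_120 hp hp5 60))
  have h5 := powSum_pDvd_one hp (show 0 < 5 by omega) (five_lt_sub_one hp hp5)
  have h6 := (powSum_pDvd_one hp (show 0 < 3 by omega) (show 3 < p - 1 by omega)).mul_right
    (PDvd.powSum hp 2 (le_refl (p - 1)))
  have hs := doubleSum_add_swap 3 2 (p - 1)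
  convert (h6.sub h5).sub (h.sub hq) using 1
  obtain ⟨q, rfl⟩ : ∃ q, p = q + 5 := ⟨p - 5, by omega⟩
  have hc : ((q + 2).choose q : ℚ) = (q + 2) * (q + 1) / 2 := by
    have h1 : (q + 2).choose q = (q + 2).choose 2 := Nat.choose_symm_add
    have h2 := Nat.descFactorial_eq_factorial_mul_choose (q + 2) 2
    rw [h1]
    have h3 : (((q + 2).descFactorial 2 : ℕ) : ℚ) = (q + 2) * (q + 1) := by
      simp [Nat.descFactorial]; ring
    rw [h2] at h3
    rw [← h3]; simp [Nat.factorial]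
  rw [show q + 5 - 3 = q + 2 by omega, show q + 5 - 5 = q by omega, hc]
  have h5 : (q : ℚ) + 2 ≠ 0 := by positivity
  rw [← hs]
  push_cast
  field_simp
  ring

/-- The alternating sum is evaluated twice modulo p²: its closed form gives P_4/4, while (-1)^k
C(p-1,k) ≡ 1 - p H_k gives -P_4 + p B_{p-5}. -/
lemma powSum_four_pDvd {p : ℕ} (hp : p.Prime) (hp5 : 5 < p) :
    PDvd p 2 (powSum 4 (p - 1) - 4 / 5 * p * bernoulli (p - 5)) := by
  have h1 : PDvd p 2 (altChooseSum 4 (p - 1) + (powSum 4 (p - 1) -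
      (p : ℚ) * doubleSum 1 4 (p - 1) - p * powSum 5 (p - 1))) := by
    have h : PDvd p 2 (-∑ i ∈ Finset.range (p - 1),
        (minusProd p (i + 1) - (1 - (p : ℚ) * powSum 1 (i + 1))) *
          (((i + 1 : ℕ) : ℚ)⁻¹) ^ 4) := by
      refine PDvd.neg (PDvd.sum fun i hi => ?_)
      have hi : i < p - 1 := by simpa using hi
      exact (minusProd_pDvd hp (by omega)).mul_right ((PDvd.inv_succ hp hi).pow 4)
    convert h using 1
    rw [altChooseSum, doubleSum, powSum, powSum, Finset.mul_sum, Finset.mul_sum,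
      ← Finset.sum_sub_distrib, ← Finset.sum_sub_distrib, ← Finset.sum_add_distrib,
      ← Finset.sum_neg_distrib]
    refine Finset.sum_congr rfl fun i hi => ?_
    have hi : i < p - 1 := by simpa using hi
    rw [minusProd_eq_choose (by omega) hp.pos, powSum_succ]
    ring
  rw [altChooseSum_four] at h1
  have g1 := powSum_pDvd_one hp (show 0 < 1 by omega) (show 1 < p - 1 by omega)
  have g2 := powSum_pDvd_one hp (show 0 < 2 by omega) (show 2 < p - 1 by omega)
  have g3 := powSum_pDvd_one hp (show 0 < 3 by omega) (show 3 < p - 1 by omega)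
  have g5 := PDvd.pow_mul 1 (powSum_pDvd_one hp (show 0 < 5 by omega) (five_lt_sub_one hp hp5))
  have i1 := PDvd.powSum hp 1 (le_refl (p - 1))
  have i2 := PDvd.powSum hp 2 (le_refl (p - 1))
  have hD := PDvd.pow_mul 1 (doubleSum_one_four_pDvd hp hp5)
  have hc := PDvd.div_120 hp hp5
  have h := ((((((h1.add g5).add hD).sub ((hc 5).mul_left ((g1.mul g1).mul_right (i1.pow 2)))).sub
    ((hc 30).mul_left ((g1.mul g1).mul_right i2))).sub ((hc 15).mul_left (g2.mul g2))).sub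
    ((hc 40).mul_left (g1.mul g3)))
  convert (hc 96).mul_left h using 1
  push_cast
  ring

/-! ### Assembly of the three congruences. -/

lemma sqProd_prime_pDvd {p : ℕ} (hp : p.Prime) (hp5 : 5 < p) :
    PDvd p 6 (sqProd p (p - 1) -
      (1 + 2 * p * powSum 1 (p - 1) - 4 / 5 * (p : ℚ) ^ 5 * bernoulli (p - 5))) := by
  have hC := sqProd_pDvd hp hp5 (le_refl (p - 1))
  have h1 := PDvd.pow_mul 1 (powSum_one_reflection hp hp5)
  have h3 := PDvd.pow_mul 3 (powSum_three_reflection hp hp5)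
  have h4 := PDvd.pow_mul 4 (powSum_four_pDvd hp hp5)
  have g2 := powSum_pDvd_one hp (show 0 < 2 by omega) (show 2 < p - 1 by omega)
  have h2 := PDvd.pow_mul 4 (g2.mul g2)
  have hc := PDvd.div_120 hp hp5
  convert (((hC.add ((hc 60).mul_left h2)).sub h1).add ((hc 60).mul_left h3)).sub h4 using 1
  push_cast
  ring

lemma binomSum_zero_pDvd {p : ℕ} (hp : p.Prime) (hp5 : 5 < p) :
    PDvd p 6 ((binomSum p 0 : ℚ) -
      (p * powSum 1 (p - 1) + 9 / 10 * (p : ℚ) ^ 5 * bernoulli (p - 5))) := by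
  have hT := PDvd.pow_mul 2 (mixedProdSum_two_pDvd hp hp5)
  have hU := minusProdSum_two hp (by omega)
  have hD := doubleSum_add_swap 2 2 (p - 1)
  have hW := PDvd.pow_mul 5 (sum_powSum_mul_pDvd hp hp5)
  have h14 := PDvd.pow_mul 5 (doubleSum_one_four_pDvd hp hp5)
  have h23 := PDvd.pow_mul 5 (doubleSum_two_three_pDvd hp hp5)
  have h4 := PDvd.pow_mul 4 (powSum_four_pDvd hp hp5)
  have g2 := powSum_pDvd_one hp (show 0 < 2 by omega) (show 2 < p - 1 by omega)
  have h2 := PDvd.pow_mul 4 (g2.mul g2)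
  have hc := PDvd.div_120 hp hp5
  rw [binomSum_zero]
  -- The coefficient 9/10 is 2/5 from P_4/2 plus 1/2 from the triple sum.
  convert (hT.sub ((hc 60).mul_left h2)).add ((hc 60).mul_left
    (((h4.add hW).sub h14).sub h23)) using 1
  push_cast
  linear_combination (p : ℚ) * hU - (p : ℚ) ^ 4 / 2 * hD

lemma binomSum_one_pDvd {p : ℕ} (hp : p.Prime) (hp5 : 5 < p) :
    PDvd p 7 ((binomSum p 1 : ℚ) -
      (-3 * (p : ℚ) ^ 2 * powSum 1 (p - 1) + 21 / 10 * (p : ℚ) ^ 6 * bernoulli (p - 5))) := by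
  have hC := PDvd.pow_mul 1 (sqProd_prime_pDvd hp hp5)
  have h0 := PDvd.pow_mul 1 (binomSum_zero_pDvd hp hp5)
  have hT := PDvd.pow_mul 4 (mixedProdSum_three_pDvd hp hp5)
  have hU := minusProdSum_three hp (by omega)
  have h23 := PDvd.pow_mul 6 (doubleSum_two_three_pDvd hp hp5)
  have h4 := PDvd.pow_mul 5 (powSum_four_pDvd hp hp5)
  have h3 := PDvd.pow_mul 4 (powSum_three_reflection hp hp5)
  have h1 := PDvd.pow_mul 2 (powSum_one_reflection hp hp5)
  have g1 := powSum_one_pDvd_two hp hp5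
  have h2 := PDvd.pow_mul 3 (g1.mul g1)
  have hc := PDvd.div_120 hp hp5
  have hrel := mixedProdSum_relation hp (by omega)
  rw [binomSum_zero] at h0
  rw [binomSum_one]
  -- The coefficient 21/10 is 4/5 from `sqProd`, -9/10 from σ_0, 2 from the double sum and 1/5 from
  -- P_2 after reflection.
  convert ((((((hT.sub hC).sub h0).sub h23).add ((hc 60).mul_left h2)).add
    ((hc 60).mul_left h1)).sub ((hc 30).mul_left h3)).add ((hc 30).mul_left h4) using 1
  push_cast
  linear_combination (p : ℚ) * hrel + (p : ℚ) ^ 2 / 2 * hU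

lemma binomSum_two_pDvd {p : ℕ} (hp : p.Prime) (hp5 : 5 < p) :
    PDvd p 8 ((binomSum p 2 : ℚ) - (-(p : ℚ) ^ 2
      - (4 * (p : ℚ) ^ 5 + 4 * (p : ℚ) ^ 4 + 2 * (p : ℚ) ^ 3) * powSum 1 (p - 1)
        + 4 / 5 * (p : ℚ) ^ 7 * bernoulli (p - 5))) := by
  have hpp := PDvd.natCast (p := p) p
  have hC := (PDvd.pow_mul 2 (sqProd_prime_pDvd hp hp5)).mul_right (hpp.sub PDvd.one)
  have h0 := (PDvd.pow_mul 3 (binomSum_zero_pDvd hp hp5)).mono (show 8 ≤ 3 + 6 by omega)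
  have h1 := (PDvd.pow_mul 2 (binomSum_one_pDvd hp hp5)).mono (show 8 ≤ 2 + 7 by omega)
  -- After multiplying through by p - 1, the two sides differ by 4p^6 H_{p-1} and (6/5)p^8 B_{p-5},
  -- both divisible by p^8.
  have hH := (PDvd.natCast 4).mul_left (PDvd.pow_mul 6 (powSum_one_pDvd_two hp hp5))
  have hB := (PDvd.div_120 hp hp5 144).mul_left (PDvd.pow_mul 8
    (bernoulli_pDvd_zero hp (show p - 5 < p - 1 by omega)))
  have hrel := mixedProdSum_zero_relation hp (by omega)
  rw [binomSum_zero] at h0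
  rw [binomSum_one] at h1
  rw [binomSum_two]
  have h := (PDvd.inv_of_lt hp (show 0 < p - 1 by omega) (by omega)).mul_left
    ((((h0.sub h1).sub hC).add hH).sub hB)
  convert h using 1
  have hne : (p : ℚ) - 1 ≠ 0 := by
    have : (5 : ℚ) < p := by exact_mod_cast hp5
    linarith
  rw [Nat.cast_sub hp.one_le, Nat.cast_one, eq_inv_mul_iff_mul_eq₀ hne]
  push_cast
  linear_combination (p : ℚ) ^ 2 * hrel

lemma PDvd.ratModEq {p n : ℕ} {a b : ℚ} (h : PDvd p n (a - b)) : RatModEq (p ^ n) a b := by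
  obtain ⟨c, hc, h⟩ := h
  exact ⟨c, hc.pow_right n, by rw [h]; push_cast; ring⟩

theorem theorem4p1 (p : ℕ) (hp : p.Prime) (hp5 : 5 < p) :
    RatModEq (p ^ 6) (binomSum p 0 : ℚ)
      ((p : ℚ) * harmonic (p - 1) + 9 / 10 * (p : ℚ) ^ 5 * bernoulli (p - 5)) ∧
    RatModEq (p ^ 7) (binomSum p 1 : ℚ)
      (-3 * (p : ℚ) ^ 2 * harmonic (p - 1) + 21 / 10 * (p : ℚ) ^ 6 * bernoulli (p - 5)) ∧
    RatModEq (p ^ 8) (binomSum p 2 : ℚ)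
      (-(p : ℚ) ^ 2 - (4 * (p : ℚ) ^ 5 + 4 * (p : ℚ) ^ 4 + 2 * (p : ℚ) ^ 3) * harmonic (p - 1)
        + 4 / 5 * (p : ℚ) ^ 7 * bernoulli (p - 5)) := by
  rw [← powSum_one_eq_harmonic]
  exact ⟨(binomSum_zero_pDvd hp hp5).ratModEq, (binomSum_one_pDvd hp hp5).ratModEq,
    (binomSum_two_pDvd hp hp5).ratModEq⟩
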